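/- Let $q\in\mathbb N$ and let all matrices below be complex $q\times q$ matrices unless said otherwise; $A^\dagger$ denotes the Moore–Penrose inverse of a complex matrix $A$. **Classes.** For a sequence $(s_j)$ and $n\ge 0$ put $H_n^{\langle s\rangle}=[s_{j+k}]_{j,k=0}^n$ (block Hankel matrix). For $\alpha\in\mathbb R$ and a sequence $(s_j)_{j=0}^m$ with $m\ge1$ put $s_{\alpha\triangleright j}=-\alpha s_j+s_{j+1}$ ($0\le j\le m-1$), the right-sided $\alpha$-shift $s_{\alpha\triangleright}$ of $s$. The class $\mathcal K^{\ge}_{q,m,\alpha}$ is the set of all sequences $(s_j)_{j=0}^m$ such that: if $m=2n$, then $H_n^{\langle s\rangle}$ and, in case $n\ge1$, also $H_{n-1}^{\langle s_{\alpha\triangleright}\rangle}$ are non-negative Hermitian; if $m=2n+1$, then $H_n^{\langle s\rangle}$ and $H_n^{\langle s_{\alpha\triangleright}\rangle}$ are non-negative Hermitian. **Parametrization.** Put $L_0^{\langle s\rangle}=s_0$ and, for $n\ge1$, $$L_n^{\langle s\rangle}=s_{2n}-[s_n,\dots,s_{2n-1}]\,(H_{n-1}^{\langle s\rangle})^\dagger\begin{bmatrix}s_n\\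 \vdots\\ s_{2n-1}\end{bmatrix}.$$ The right-sided $\alpha$-Stieltjes parametrization of $(s_j)_{j=0}^m$ is the sequence $(Q_j)_{j=0}^m$ with $Q_{2k}=L_k^{\langle s\rangle}$ for $2k\le m$ and $Q_{2k+1}=L_k^{\langle s_{\alpha\triangleright}\rangle}$ for $2k+1\le m$. **Schur-type transform.** For a sequence $(u_j)_{j=0}^m$ its reciprocal sequence $(u_j^\sharp)_{j=0}^m$ is given by $u_0^\sharp=u_0^\dagger$ and $u_j^\sharp=-u_0^\dagger\sum_{l=0}^{j-1}u_{j-l}u_l^\sharp$ for $j\ge1$. For a sequence $(s_j)_{j=0}^m$ with $m\ge1$ let $u_0=s_0$ and $u_j=-\alpha s_{j-1}+s_j$ for $1\le j\le m$. The first $\alpha$-Schur transform of $(s_j)_{j=0}^m$ is the sequence $(-s_0u_{j+1}^\sharp s_0)_{j=0}^{m-1}$. The $0$-th $\alpha$-Schur transform of $(s_j)_{j=0}^m$ is the sequence itself and, for $1\le k\le m$, the $k$-th $\alpha$-Schur transform is the first $\alpha$-Schur transform of the $(k-1)$-th one; it is denoted by $(s_j^{[k,\alpha]})_{j=0}^{m-k}$.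 For $0\le k\le m$ and $0\le j\le m-k$ put $$P_{j,k}=s_j^{[k,\alpha]}-s_0^{[k,\alpha]}(s_0^{[k,\alpha]})^\dagger s_j^{[k,\alpha]}(s_0^{[k,\alpha]})^\dagger s_0^{[k,\alpha]}.$$ **Theorem.** Let $\alpha\in\mathbb R$, let $m\ge0$ be an integer, let $(s_j)_{j=0}^m\in\mathcal K^{\ge}_{q,m,\alpha}$, and let $0\le k\le m$. Let $(Q_j)_{j=0}^m$ be the right-sided $\alpha$-Stieltjes parametrization of $(s_j)_{j=0}^m$ and let $(T_j)_{j=0}^{m-k}$ be the right-sided $\alpha$-Stieltjes parametrization of the $k$-th $\alpha$-Schur transform $(s_j^{[k,\alpha]})_{j=0}^{m-k}$. Then $T_j=Q_{k+j}$ for all integers $j$ with $0\le j<m-k$, and $$T_{m-k}=Q_m-\sum_{r=0}^{k-1}P_{m-r,r},$$ where the sum is empty, i.e. $T_m=Q_m$, in the case $k=0$. -/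

import Mathlib

open Matrix
open scoped BigOperators ComplexOrder

namespace StieltjesSchur

/-! ### The Moore-Penrose inverse of a complex matrix -/

section MoorePenrose

variable {m n : Type*} [Fintype m] [Fintype n]

/-- `X` satisfies the four Penrose equations for `A`. -/
structure IsMoorePenrose (A : Matrix m n ℂ) (X : Matrix n m ℂ) : Prop where
  mul_mul_left : A * X * A = A
  mul_mul_right : X * A * X = X
  hermitian_left : (A * X)ᴴ = A * X
  hermitian_right : (X * A)ᴴ = X * A

theorem IsMoorePenrose.unique {A : Matrix m n ℂ} {X Y : Matrix n m ℂ}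
    (hX : IsMoorePenrose A X) (hY : IsMoorePenrose A Y) : X = Y := by
  have h1 : A * X = A * Y := by
    calc A * X = (A * Y * A) * X := by rw [hY.mul_mul_left]
      _ = (A * Y)ᴴ * (A * X)ᴴ := by
          rw [hY.hermitian_left, hX.hermitian_left, Matrix.mul_assoc (A * Y)]
      _ = (A * X * A * Y)ᴴ := by rw [← conjTranspose_mul, ← Matrix.mul_assoc]
      _ = A * Y := by rw [hX.mul_mul_left, hY.hermitian_left]
  have h2 : X * A = Y * A := by
    calc X * A = X * (A * Y * A) := by rw [hY.mul_mul_left]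
      _ = (X * A)ᴴ * (Y * A)ᴴ := by
          rw [hY.hermitian_right, hX.hermitian_right, Matrix.mul_assoc A, ← Matrix.mul_assoc X]
      _ = (Y * (A * X * A))ᴴ := by
          rw [← conjTranspose_mul, Matrix.mul_assoc A, ← Matrix.mul_assoc Y]
      _ = Y * A := by rw [hX.mul_mul_left, hY.hermitian_right]
  calc X = X * A * X := hX.mul_mul_right.symm
    _ = Y * A * X := by rw [h2]
    _ = Y * (A * X) := Matrix.mul_assoc _ _ _
    _ = Y * A * Y := by rw [h1, Matrix.mul_assoc]
    _ = Y := hY.mul_mul_right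

theorem exists_isMoorePenrose [DecidableEq n] (A : Matrix m n ℂ) :
    ∃ X : Matrix n m ℂ, IsMoorePenrose A X := by
  have hB : (Aᴴ * A).IsHermitian := isHermitian_conjTranspose_mul_self A
  obtain ⟨U, d, hU, hS⟩ : ∃ (U : Matrix n n ℂ) (d : n → ℝ), Uᴴ * U = 1 ∧
      Aᴴ * A = U * diagonal (fun i => (d i : ℂ)) * Uᴴ := by
    refine ⟨(hB.eigenvectorUnitary : Matrix n n ℂ), hB.eigenvalues, ?_, ?_⟩
    · exact (Matrix.mem_unitaryGroup_iff'.1 hB.eigenvectorUnitary.2)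
    · have := hB.spectral_theorem
      rw [Unitary.conjStarAlgAut_apply] at this
      exact this
  set D : Matrix n n ℂ := diagonal (fun i => (d i : ℂ)) with hD
  set E : Matrix n n ℂ := diagonal (fun i => ((d i)⁻¹ : ℂ)) with hE
  have hDED : D * E * D = D := by
    simp only [hD, hE, diagonal_mul_diagonal]
    congr 1; funext i
    by_cases h : (d i : ℂ) = 0
    · simp [h]
    · field_simp
  have hEDE : E * D * E = E := by
    simp only [hD, hE, diagonal_mul_diagonal]
    congr 1; funext i
    by_cases h : (d i : ℂ) = 0
    · simp [h]
    · field_simp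
  have hEstar : Eᴴ = E := by
    simp only [hE, diagonal_conjTranspose]
    congr 1; funext i; simp
  have hcomm : E * D = D * E := by
    simp only [hD, hE, diagonal_mul_diagonal]
    congr 1; funext i; ring
  have hDstar : Dᴴ = D := by
    simp only [hD, diagonal_conjTranspose]
    congr 1; funext i; simp
  -- `P` is the Moore-Penrose inverse of `Aᴴ * A`
  obtain ⟨P, hPdef⟩ : ∃ P : Matrix n n ℂ, P = U * E * Uᴴ := ⟨_, rfl⟩
  have hPs : Pᴴ = P := by
    rw [hPdef]; simp [conjTranspose_mul, hEstar, Matrix.mul_assoc]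
  have key : ∀ X Y : Matrix n n ℂ, (U * X * Uᴴ) * (U * Y * Uᴴ) = U * (X * Y) * Uᴴ := by
    intro X Y
    calc (U * X * Uᴴ) * (U * Y * Uᴴ) = U * X * (Uᴴ * U) * Y * Uᴴ := by
          simp only [Matrix.mul_assoc]
      _ = U * (X * Y) * Uᴴ := by rw [hU]; simp only [Matrix.mul_assoc, Matrix.one_mul]
  have hBPB : (Aᴴ * A) * P * (Aᴴ * A) = Aᴴ * A := by
    rw [hS, hPdef, key, key, hDED]
  have hPBP : P * (Aᴴ * A) * P = P := by
    rw [hS, hPdef, key, key, hEDE]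
  have hPB : (P * (Aᴴ * A))ᴴ = P * (Aᴴ * A) := by
    rw [hS, hPdef, key, conjTranspose_mul, conjTranspose_mul, conjTranspose_conjTranspose,
      conjTranspose_mul, hDstar, hEstar, ← hcomm]
    simp only [Matrix.mul_assoc]
  have hPA : A * P * (Aᴴ * A) = A := by
    rw [← sub_eq_zero, ← Matrix.conjTranspose_mul_self_eq_zero]
    have h0 : Aᴴ * (A * P * (Aᴴ * A) - A) = 0 := by
      rw [Matrix.mul_sub, sub_eq_zero]
      calc Aᴴ * (A * P * (Aᴴ * A)) = (Aᴴ * A) * P * (Aᴴ * A) := by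
            simp only [Matrix.mul_assoc]
        _ = Aᴴ * A := hBPB
    have h1 : (A * P * (Aᴴ * A) - A)ᴴ = (P * (Aᴴ * A) - 1)ᴴ * Aᴴ := by
      rw [← conjTranspose_mul]
      congr 1
      rw [Matrix.mul_sub, Matrix.mul_one, Matrix.mul_assoc]
    rw [h1, Matrix.mul_assoc, h0, Matrix.mul_zero]
  refine ⟨P * Aᴴ, ?_, ?_, ?_, ?_⟩
  · calc A * (P * Aᴴ) * A = A * P * (Aᴴ * A) := by simp only [Matrix.mul_assoc]
      _ = A := hPA
  · calc P * Aᴴ * A * (P * Aᴴ) = (P * (Aᴴ * A) * P) * Aᴴ := by simp only [Matrix.mul_assoc]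
      _ = P * Aᴴ := by rw [hPBP]
  · simp [conjTranspose_mul, hPs, Matrix.mul_assoc]
  · rw [Matrix.mul_assoc]; exact hPB

/-- The Moore-Penrose inverse `A†` of a complex matrix `A`. -/
noncomputable def mpInv [DecidableEq n] (A : Matrix m n ℂ) : Matrix n m ℂ :=
  (exists_isMoorePenrose A).choose

theorem mpInv_spec [DecidableEq n] (A : Matrix m n ℂ) : IsMoorePenrose A (mpInv A) :=
  (exists_isMoorePenrose A).choose_spec

end MoorePenrose

/-! ### Sequences of complex matrices

A sequence `(s_j)_{j=0}^m` is represented by a function `s : ℕ → Matrix _ _ ℂ`, of which only the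
values `s 0, …, s m` are relevant: every notion below for `(s_j)_{j=0}^m` involves only these
values. -/

section Sequences

variable {p q : ℕ}

/-- The block Hankel matrix `H_n = [s_{j+k}]_{j,k=0}^n`. -/
def blockHankel (s : ℕ → Matrix (Fin p) (Fin q) ℂ) (n : ℕ) :
    Matrix (Fin (n + 1) × Fin p) (Fin (n + 1) × Fin q) ℂ :=
  fun a b => s ((a.1 : ℕ) + (b.1 : ℕ)) a.2 b.2

/-- The block column with `n` blocks `s_l, s_{l+1}, …, s_{l+n-1}`. -/
def blockCol (s : ℕ → Matrix (Fin p) (Fin q) ℂ) (l n : ℕ) : Matrix (Fin n × Fin p) (Fin q) ℂ :=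
  fun a j => s (l + (a.1 : ℕ)) a.2 j

/-- The block row with `n` blocks `s_l, s_{l+1}, …, s_{l+n-1}`. -/
def blockRow (s : ℕ → Matrix (Fin p) (Fin q) ℂ) (l n : ℕ) : Matrix (Fin p) (Fin n × Fin q) ℂ :=
  fun i b => s (l + (b.1 : ℕ)) i b.2

/-- The sequence `-α s_j + s_{j+1}` generated from `s` by right-sided `α`-shifting. -/
def rightShift (α : ℂ) (s : ℕ → Matrix (Fin p) (Fin q) ℂ) : ℕ → Matrix (Fin p) (Fin q) ℂ :=
  fun j => -(α • s j) + s (j + 1)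

/-- `(s_j)_{j=0}^{2n}` is Hankel non-negative definite. -/
def HankelNonneg (n : ℕ) (s : ℕ → Matrix (Fin q) (Fin q) ℂ) : Prop :=
  (blockHankel s n).PosSemidef

/-- The class `K^≥_{q,m,α}` of `α`-Stieltjes (right-sided) non-negative definite sequences
`(s_j)_{j=0}^m` of complex `q × q` matrices. -/
def StieltjesNonneg (α : ℝ) (m : ℕ) (s : ℕ → Matrix (Fin q) (Fin q) ℂ) : Prop :=
  (∀ n, m = 2 * n →
    HankelNonneg n s ∧ (1 ≤ n → HankelNonneg (n - 1) (rightShift (α : ℂ) s))) ∧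
  (∀ n, m = 2 * n + 1 → HankelNonneg n s ∧ HankelNonneg n (rightShift (α : ℂ) s))

/-- `L_0 = s_0` and `L_n = s_{2n} - [s_n, …, s_{2n-1}] H_{n-1}† col(s_n, …, s_{2n-1})`
for `n ≥ 1`. -/
noncomputable def schurCompl (s : ℕ → Matrix (Fin p) (Fin q) ℂ) : ℕ → Matrix (Fin p) (Fin q) ℂ
  | 0 => s 0
  | n + 1 => s (2 * (n + 1)) -
      blockRow s (n + 1) (n + 1) * mpInv (blockHankel s n) * blockCol s (n + 1) (n + 1)

/-- The right-sided `α`-Stieltjes parametrization: `Q_{2k} = L_k` and `Q_{2k+1}` is `L_k` formed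
from the right-sided `α`-shift of `s`. -/
noncomputable def stieltjesParam (α : ℂ) (s : ℕ → Matrix (Fin p) (Fin q) ℂ) (j : ℕ) :
    Matrix (Fin p) (Fin q) ℂ :=
  if Even j then schurCompl s (j / 2) else schurCompl (rightShift α s) (j / 2)

/-- The reciprocal sequence: `r_0 = s_0†` and `r_j = -s_0† ∑_{l=0}^{j-1} s_{j-l} r_l`. -/
noncomputable def recipSeq (s : ℕ → Matrix (Fin p) (Fin q) ℂ) : ℕ → Matrix (Fin q) (Fin p) ℂ
  | 0 => mpInv (s 0)
  | j + 1 => -(mpInv (s 0) * ∑ l : Fin (j + 1), s (j + 1 - (l : ℕ)) * recipSeq s (l : ℕ))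
decreasing_by exact l.isLt

/-- The `(+,α)`-transform: `-α s_{j-1} + s_j` with `s_{-1} = 0`. -/
def plusTransform (α : ℂ) (s : ℕ → Matrix (Fin p) (Fin q) ℂ) : ℕ → Matrix (Fin p) (Fin q) ℂ
  | 0 => s 0
  | j + 1 => -(α • s j) + s (j + 1)

/-- The first `α`-Schur transform `s_0 (-r_{j+1}) s_0`, where `r` is the reciprocal sequence of
the `(+,α)`-transform of `s`. -/
noncomputable def schurTransform (α : ℂ) (s : ℕ → Matrix (Fin p) (Fin q) ℂ) :
    ℕ → Matrix (Fin p) (Fin q) ℂ :=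
  fun j => s 0 * (-(recipSeq (plusTransform α s) (j + 1))) * s 0

/-- The `k`-th `α`-Schur transform; for `(s_j)_{j=0}^m` with `k ≤ m` it has the entries
`0, …, m - k`. -/
noncomputable def schurIter (α : ℂ) (s : ℕ → Matrix (Fin p) (Fin q) ℂ) :
    ℕ → ℕ → Matrix (Fin p) (Fin q) ℂ
  | 0 => s
  | k + 1 => schurTransform α (schurIter α s k)

/-- `P_{j,k} = t_j - t_0 t_0† t_j t_0† t_0`, where `t` is the `k`-th `α`-Schur transform. -/
noncomputable def defectTerm (α : ℂ) (s : ℕ → Matrix (Fin p) (Fin q) ℂ) (j k : ℕ) :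
    Matrix (Fin p) (Fin q) ℂ :=
  schurIter α s k j -
    schurIter α s k 0 * mpInv (schurIter α s k 0) * schurIter α s k j *
      mpInv (schurIter α s k 0) * schurIter α s k 0

end Sequences

end StieltjesSchur

/-! The theorem reduces to one transform step, `StieltjesNonneg.schurTransform`; induction on `k`
then collects one defect term per step.

Let `e = s₀ s₀†`, the orthogonal projection onto the range of `s₀`. Non-negativity forces `e s_j =
s_j = s_j e` for every entry except possibly the last (`StieltjesNonneg.mul_proj`). Replacing the
last entry by its compression `e s_m e` leaves the transform unchanged, because reciprocal sequences
see only compressions, and lowers the last parameter by exactly the defect term, because `Q_m - s_m`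
depends only on earlier entries.

For a compressed sequence, use generating functions. With `S` that of `s`, `U = (1 - αz)S` and `r`
the inverse of `U` in the corner with unit `e`, the transform `T` satisfies `zT = s₀ - s₀ r s₀`.
This yields two congruences by lower triangular block Toeplitz matrices with diagonal `e`: one takes
the Hankel matrix of the shift of `s` to that of `T` (`schurTransform_hankel_factorization`), the
other takes the Hankel matrix of `s` to the block diagonal sum of `s₀` and the Hankel matrix of the
shift of `T` (`hankel_factorization`). Such congruences preserve non-negativity and the last Schur
complement. The two families of Schur complements thus swap roles, which moves the parametrization
by one index. -/

namespace StieltjesSchur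

/-! ### Hankel–Toeplitz products as power series identities -/

section HankelColumns

open PowerSeries

variable {R : Type*} [Ring R]

/-- The generating function of the `k`-th column of `H * Gᵗ`, where `H` is the infinite Hankel
matrix of `a` and `Gᵗ` the upper triangular Toeplitz matrix of `G`. -/
noncomputable def hankelColumn (a : ℕ → R) (G : R⟦X⟧) (k : ℕ) : R⟦X⟧ :=
  ∑ p ∈ Finset.HasAntidiagonal.antidiagonal k, mk (fun j => a (j + p.1)) * C (coeff p.2 G)

/-- Bridge from series to matrices: the right side is the `(j, k)` block of lower triangular
Toeplitz times Hankel times upper triangular Toeplitz. -/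
theorem coeff_mul_hankelColumn (F G : R⟦X⟧) (a : ℕ → R) (j k : ℕ) :
    coeff j (F * hankelColumn a G k) =
      ∑ i ∈ Finset.range (j + 1), ∑ l ∈ Finset.range (k + 1),
        coeff (j - i) F * a (i + l) * coeff (k - l) G := by
  rw [hankelColumn, Finset.mul_sum, map_sum, Finset.Nat.sum_antidiagonal_eq_sum_range_succ_mk,
    Finset.sum_comm]
  refine Finset.sum_congr rfl fun l _ => ?_
  rw [← mul_assoc, coeff_mul_C, coeff_mul, Finset.Nat.antidiagonal_eq_map', Finset.sum_map,
    Finset.sum_mul]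
  simp only [coeff_mk]
  rfl

theorem X_mul_mk_succ (a : ℕ → R) (l : ℕ) :
    X * mk (fun j => a (j + (l + 1))) = mk (fun j => a (j + l)) - C (a l) := by
  ext j
  rcases j with _ | j
  · simp
  · rw [coeff_succ_X_mul]
    simp [add_assoc, add_comm 1 l]

/-- Multiplication by `X` undoes one Hankel shift up to a constant term; the lost constants add up
to a coefficient of `mk a * G`. Only the unshifted summand has no shift to undo. This recursion
drives both factorizations. -/
theorem X_mul_hankelColumn_succ (a : ℕ → R) (G : R⟦X⟧) (k : ℕ) :
    X * hankelColumn a G (k + 1) =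
      X * mk a * C (coeff (k + 1) G) + hankelColumn a G k - C (coeff k (mk a * G)) := by
  have h : C (coeff k (mk a * G)) =
      ∑ p ∈ Finset.HasAntidiagonal.antidiagonal k, C (a p.1) * C (coeff p.2 G) := by
    simp [coeff_mul]
  rw [h, hankelColumn, Finset.Nat.sum_antidiagonal_succ, mul_add, hankelColumn, add_sub_assoc,
    ← Finset.sum_sub_distrib, Finset.mul_sum]
  congr 1
  · simp [mul_assoc]
  · refine Finset.sum_congr rfl fun p _ => ?_
    rw [← mul_assoc, X_mul_mk_succ, sub_mul]

theorem X_mul_cancel {f g : R⟦X⟧} (h : X * f = X * g) : f = g := by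
  ext j
  have := congrArg (coeff (j + 1)) h
  simpa [coeff_succ_X_mul] using this

/-- Generating function form of the factorization of the Hankel matrix of the Schur transform
`t` by means of the Hankel matrix of the shifted sequence `a`. -/
theorem mul_hankelColumn_of_schur {e d s₀ : R} {a t : ℕ → R} {r : R⟦X⟧}
    (hds : d * s₀ = e) (hsd : s₀ * d = e) (hse : s₀ * e = s₀)
    (her : C e * r = r) (ha : ∀ j, a j * e = a j) (het : ∀ j, e * t j = t j)
    (hUr : (C s₀ + X * mk a) * r = C e) (hrU : r * (C s₀ + X * mk a) = C e)
    (ht : X * mk t = C s₀ - C s₀ * r * C s₀) (hr : coeff 0 r = d) (k : ℕ) :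
    C s₀ * r * hankelColumn a (r * C s₀) k = mk (fun j => t (j + k)) := by
  have hes : e * s₀ = s₀ := by rw [← hsd, mul_assoc, hds, hse]
  have hae : mk a * C e = mk a := by ext j; simp [ha]
  -- Write `X * mk a` as `U - s₀`, where `U` is inverse to `r` in the corner of `e`; the other order
  -- gives `haG`.
  have hGa : C s₀ * r * (X * mk a) = C s₀ - C s₀ * r * C s₀ := by
    have : r * (X * mk a) = C e - r * C s₀ := by rw [← hrU]; noncomm_ring
    rw [mul_assoc, this, mul_sub, ← map_mul, hse, mul_assoc]
  have haG : mk a * (r * C s₀) = mk t := by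
    apply X_mul_cancel
    have : X * mk a * r = C e - C s₀ * r := by rw [← hUr]; noncomm_ring
    rw [ht, ← mul_assoc, ← mul_assoc, this, sub_mul, ← map_mul, hes]
  have hG' : ∀ k, coeff (k + 1) (r * C s₀) = -(d * t k) := by
    intro k
    have h1 : r * C s₀ = C e - C d * (X * mk t) := by
      rw [ht, mul_sub, ← map_mul, hds, ← mul_assoc, ← mul_assoc, ← map_mul, hds, her]
      abel
    rw [h1, map_sub, coeff_C_mul, coeff_succ_X_mul]
    simp
  induction k with
  | zero =>
    apply X_mul_cancel
    have h0 : hankelColumn a (r * C s₀) 0 = mk a := by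
      have : coeff 0 (r * C s₀) = e := by rw [coeff_mul_C, hr, hds]
      simp only [hankelColumn, Finset.Nat.antidiagonal_zero, Finset.sum_singleton, this, add_zero]
      exact hae
    rw [h0, ← mul_assoc, ← (commute_X (C s₀ * r)).eq, mul_assoc, hGa, ← ht]
    rfl
  | succ k ih =>
    apply X_mul_cancel
    rw [X_mul_mk_succ, ← ih, ← mul_assoc, ← (commute_X (C s₀ * r)).eq, mul_assoc,
      X_mul_hankelColumn_succ, haG, coeff_mk, hG', mul_sub, mul_add, ← mul_assoc, hGa]
    -- The term `s₀ r t_k` produced here cancels the one subtracted by the recursion, leaving the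
    -- shifted series minus its constant term.
    have h2 : (C s₀ - C s₀ * r * C s₀) * C (-(d * t k)) =
        C s₀ * r * C (t k) - C (t k) := by
      have h3 : C s₀ * (C d * C (t k)) = C (t k) := by
        rw [← map_mul, ← map_mul, ← mul_assoc, hsd, het]
      rw [map_neg, map_mul, mul_neg, sub_mul, h3, mul_assoc (C s₀ * r), h3]
      abel
    rw [h2]
    abel

/-- Generating function form of the factorization of the Hankel matrix of `s` by means of `s₀`
and the Hankel matrix of the shifted Schur transform `b`. -/
theorem mul_hankelColumn_succ_of_schur {e c : R} {s b : ℕ → R} {F F' : R⟦X⟧}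
    (hse : s 0 * e = s 0)
    (hF : F * mk s = C (s 0)) (hF' : mk s * F' = C (s 0)) (hF0 : coeff 0 F' = e)
    (hFF' : F * C (s 0) = C (s 0) * F')
    (hb : X * (X * mk b) = C (s 0) - F * C (s 0) - X * C c) (k : ℕ) :
    F * hankelColumn s F' 0 = C (s 0) ∧
    F * hankelColumn s F' (k + 1) = X * mk (fun j => b (j + k)) := by
  have h0 : F * hankelColumn s F' 0 = C (s 0) := by
    simp only [hankelColumn, Finset.Nat.antidiagonal_zero, Finset.sum_singleton, hF0, add_zero]
    rw [← mul_assoc]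
    erw [hF]
    rw [← map_mul, hse]
  refine ⟨h0, ?_⟩
  have hstep : ∀ k, X * (F * hankelColumn s F' (k + 1)) =
      X * C (s 0 * coeff (k + 1) F') + F * hankelColumn s F' k - F * C (coeff k (C (s 0))) := by
    intro k
    rw [← mul_assoc, ← (commute_X F).eq, mul_assoc, X_mul_hankelColumn_succ, hF', mul_sub, mul_add,
      ← mul_assoc, ← mul_assoc, (commute_X F).eq, mul_assoc X F, hF, mul_assoc X, ← map_mul]
  have hc : ∀ k, s 0 * coeff (k + 1) F' = coeff (k + 1) (F * C (s 0)) := by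
    intro k
    rw [hFF', coeff_C_mul]
  induction k with
  | zero =>
    apply X_mul_cancel
    -- The linear coefficient of `hb`: this is where the otherwise arbitrary `c` is absorbed.
    have h1 : s 0 * coeff 1 F' = -c := by
      have := congrArg (coeff 1) hb
      rw [coeff_succ_X_mul, map_sub, map_sub, coeff_succ_X_mul] at this
      rw [hc]
      simp at this ⊢
      rw [eq_comm, sub_eq_zero] at this
      rw [← this]; simp
    rw [hstep, h0, zero_add, h1]
    simp only [coeff_zero_C, map_neg, add_zero]
    rw [hb]
    noncomm_ring
  | succ k ih =>
    apply X_mul_cancel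
    have h1 : s 0 * coeff (k + 2) F' = -b k := by
      have := congrArg (coeff (k + 2)) hb
      rw [coeff_succ_X_mul, map_sub, map_sub, coeff_succ_X_mul, coeff_succ_X_mul] at this
      rw [hc]
      simp at this ⊢
      rw [this]; simp
    rw [hstep, ih, X_mul_mk_succ, h1]
    simp [mul_sub]
    abel

end HankelColumns

/-! ### Finite block matrices and congruence -/

section BlockMatrices

variable {q : ℕ}

/-- The finite block matrix `[f j k]_{j,k < N}`. -/
def blockMatrix (N : ℕ) (f : ℕ → ℕ → Matrix (Fin q) (Fin q) ℂ) :
    Matrix (Fin N × Fin q) (Fin N × Fin q) ℂ :=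
  fun a b => f a.1 b.1 a.2 b.2

theorem blockMatrix_congr {N : ℕ} {f g : ℕ → ℕ → Matrix (Fin q) (Fin q) ℂ}
    (h : ∀ j < N, ∀ k < N, f j k = g j k) : blockMatrix N f = blockMatrix N g := by
  ext a b
  simp [blockMatrix, h a.1 a.1.2 b.1 b.1.2]

theorem blockMatrix_mul (N : ℕ) (f g : ℕ → ℕ → Matrix (Fin q) (Fin q) ℂ) :
    blockMatrix N f * blockMatrix N g =
      blockMatrix N (fun j k => ∑ l ∈ Finset.range N, f j l * g l k) := by
  ext a b
  simp [blockMatrix, Matrix.mul_apply, Fintype.sum_prod_type, Finset.sum_range, Matrix.sum_apply]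

theorem blockMatrix_conjTranspose (N : ℕ) (f : ℕ → ℕ → Matrix (Fin q) (Fin q) ℂ) :
    (blockMatrix N f)ᴴ = blockMatrix N (fun j k => (f k j)ᴴ) := rfl

theorem blockMatrix_posSemidef_shift {N : ℕ} {f : ℕ → ℕ → Matrix (Fin q) (Fin q) ℂ}
    (h : (blockMatrix (N + 1) f).PosSemidef) :
    (blockMatrix N (fun j k => f (j + 1) (k + 1))).PosSemidef := by
  have := h.submatrix (fun a : Fin N × Fin q => (a.1.succ, a.2))
  convert this using 1
  ext a b
  simp [blockMatrix]

theorem blockMatrix_posSemidef_mono {N N' : ℕ} (hN : N' ≤ N)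
    {f : ℕ → ℕ → Matrix (Fin q) (Fin q) ℂ} (h : (blockMatrix N f).PosSemidef) :
    (blockMatrix N' f).PosSemidef := by
  have := h.submatrix (fun a : Fin N' × Fin q => (a.1.castLE hN, a.2))
  convert this using 1
  ext a b
  simp [blockMatrix]

theorem blockMatrix_apply_conjTranspose {N : ℕ} {f : ℕ → ℕ → Matrix (Fin q) (Fin q) ℂ}
    (h : (blockMatrix N f).PosSemidef) {j k : ℕ} (hj : j < N) (hk : k < N) :
    (f j k)ᴴ = f k j := by
  ext x y
  have := congrFun (congrFun h.isHermitian (⟨k, hk⟩, x)) (⟨j, hj⟩, y)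
  simpa [blockMatrix, conjTranspose_apply] using this

theorem sum_range_succ_eq_sum_ite {A : Type*} [AddCommMonoid A] {N j : ℕ} (hj : j < N)
    (φ : ℕ → A) :
    ∑ i ∈ Finset.range (j + 1), φ i = ∑ i ∈ Finset.range N, if i ≤ j then φ i else 0 := by
  rw [← Finset.sum_filter]
  refine Finset.sum_congr ?_ fun _ _ => rfl
  ext i
  simp only [Finset.mem_range, Finset.mem_filter]
  omega

/-- Multiplication by a lower triangular block Toeplitz matrix and its adjoint preserves
non-negativity. -/
theorem blockMatrix_posSemidef_toeplitz {N : ℕ} {f K : ℕ → ℕ → Matrix (Fin q) (Fin q) ℂ}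
    {g : ℕ → Matrix (Fin q) (Fin q) ℂ}
    (hK : ∀ j < N, ∀ k < N, K j k = ∑ i ∈ Finset.range (j + 1), ∑ l ∈ Finset.range (k + 1),
      g (j - i) * f i l * (g (k - l))ᴴ)
    (h : (blockMatrix N f).PosSemidef) : (blockMatrix N K).PosSemidef := by
  have := h.mul_mul_conjTranspose_same
    (blockMatrix N (fun j i => if i ≤ j then g (j - i) else 0))
  convert this using 1
  rw [blockMatrix_conjTranspose, blockMatrix_mul, blockMatrix_mul]
  refine blockMatrix_congr fun j hj k hk => ?_
  rw [hK j hj k hk, sum_range_succ_eq_sum_ite hj]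
  simp_rw [Finset.sum_mul]
  rw [Finset.sum_comm]
  refine Finset.sum_congr rfl fun i _ => ?_
  split_ifs with hij
  · rw [sum_range_succ_eq_sum_ite hk]
    refine Finset.sum_congr rfl fun l _ => ?_
    split_ifs <;> simp
  · simp

end BlockMatrices

/-! ### Last Schur complements through block columns -/

section SchurComplement

variable {q : ℕ}

/-- `X` is the last block of `f * Y` for some block column `Y` with last block `1` such that all
other blocks of `f * Y` vanish; here `f` has the blocks `f j k`, `j, k ≤ N`. -/
def IsLastSchurBlock (f : ℕ → ℕ → Matrix (Fin q) (Fin q) ℂ) (N : ℕ)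
    (X : Matrix (Fin q) (Fin q) ℂ) : Prop :=
  ∃ Y : ℕ → Matrix (Fin q) (Fin q) ℂ, Y N = 1 ∧
    ∀ j ≤ N, ∑ k ∈ Finset.range (N + 1), f j k * Y k = if j = N then X else 0

theorem IsLastSchurBlock.congr {f g : ℕ → ℕ → Matrix (Fin q) (Fin q) ℂ} {N : ℕ}
    {X : Matrix (Fin q) (Fin q) ℂ} (hX : IsLastSchurBlock f N X)
    (h : ∀ j ≤ N, ∀ k ≤ N, f j k = g j k) : IsLastSchurBlock g N X := by
  obtain ⟨Y, hY, hf⟩ := hX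
  refine ⟨Y, hY, fun j hj => ?_⟩
  rw [← hf j hj]
  refine Finset.sum_congr rfl fun k hk => ?_
  rw [h j hj k (Nat.lt_succ_iff.1 (Finset.mem_range.1 hk))]

/-- Evaluate `Y'ᴴ f Y` in two ways: `f Y` has only the last block `X`, and `(f Y')ᴴ` only the last
block `X'ᴴ`. -/
theorem IsLastSchurBlock.eq_conjTranspose {f : ℕ → ℕ → Matrix (Fin q) (Fin q) ℂ} {N : ℕ}
    {X X' : Matrix (Fin q) (Fin q) ℂ} (hf : ∀ j ≤ N, ∀ k ≤ N, (f j k)ᴴ = f k j)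
    (hX : IsLastSchurBlock f N X) (hX' : IsLastSchurBlock f N X') : X = X'ᴴ := by
  obtain ⟨Y, hY, h⟩ := hX
  obtain ⟨Y', hY', h'⟩ := hX'
  have h1 : ∑ j ∈ Finset.range (N + 1), (Y' j)ᴴ *
      ∑ k ∈ Finset.range (N + 1), f j k * Y k = X := by
    rw [Finset.sum_eq_single N]
    · rw [h N le_rfl, hY']; simp
    · intro j hj hjN
      rw [h j (Nat.lt_succ_iff.1 (Finset.mem_range.1 hj)), if_neg hjN, mul_zero]
    · simp
  have h2 : ∑ k ∈ Finset.range (N + 1), (∑ j ∈ Finset.range (N + 1), f k j * Y' j)ᴴ * Y k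
      = X'ᴴ := by
    rw [Finset.sum_eq_single N]
    · rw [h' N le_rfl, hY]; simp
    · intro j hj hjN
      rw [h' j (Nat.lt_succ_iff.1 (Finset.mem_range.1 hj)), if_neg hjN]; simp
    · simp
  rw [← h1, ← h2]
  simp_rw [Finset.mul_sum, conjTranspose_sum, Finset.sum_mul]
  rw [Finset.sum_comm]
  refine Finset.sum_congr rfl fun k hk => Finset.sum_congr rfl fun j hj => ?_
  rw [conjTranspose_mul, hf k (Nat.lt_succ_iff.1 (Finset.mem_range.1 hk)) j
    (Nat.lt_succ_iff.1 (Finset.mem_range.1 hj)), mul_assoc]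

/-- Positivity enters only through Hermitian symmetry: comparing `X` with `X'`, and `X'` with
itself, gives `X = X'ᴴ = X'`. -/
theorem IsLastSchurBlock.unique {f : ℕ → ℕ → Matrix (Fin q) (Fin q) ℂ} {N : ℕ}
    {X X' : Matrix (Fin q) (Fin q) ℂ} (hf : (blockMatrix (N + 1) f).PosSemidef)
    (hX : IsLastSchurBlock f N X) (hX' : IsLastSchurBlock f N X') : X = X' := by
  have hf' : ∀ j ≤ N, ∀ k ≤ N, (f j k)ᴴ = f k j := fun j hj k hk =>
    blockMatrix_apply_conjTranspose hf (Nat.lt_succ_of_le hj) (Nat.lt_succ_of_le hk)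
  rw [hX.eq_conjTranspose hf' hX', ← hX'.eq_conjTranspose hf' hX']

/-- The triangular factors have diagonal `e` and need not be invertible, but `f` lives in the corner
of `e`. Forward substitution there removes the left factor, and the right factor is absorbed into
the block column. -/
theorem IsLastSchurBlock.of_toeplitz {N : ℕ} {f K : ℕ → ℕ → Matrix (Fin q) (Fin q) ℂ}
    {g g' : ℕ → Matrix (Fin q) (Fin q) ℂ} {e X : Matrix (Fin q) (Fin q) ℂ}
    (hK : ∀ j ≤ N, ∀ k ≤ N, K j k = ∑ i ∈ Finset.range (j + 1), ∑ l ∈ Finset.range (k + 1),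
      g (j - i) * f i l * g' (k - l))
    (hg : g 0 = e) (hg' : g' 0 = e) (hef : ∀ j k, e * f j k = f j k)
    (hfe : ∀ j k, f j k * e = f j k) (hX : IsLastSchurBlock K N X) :
    IsLastSchurBlock f N X := by
  obtain ⟨Y, hY, hKY⟩ := hX
  set V : ℕ → Matrix (Fin q) (Fin q) ℂ := fun l =>
    ∑ k ∈ Finset.range (N + 1), if l ≤ k then g' (k - l) * Y k else 0 with hV
  set W : ℕ → Matrix (Fin q) (Fin q) ℂ := fun i =>
    ∑ l ∈ Finset.range (N + 1), f i l * V l with hW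
  -- The last block of `V` is `e`, not `1`. Adding `(1 - e) * Y l` repairs this at no cost, since
  -- `f` annihilates it.
  have hWV : ∀ i, ∑ l ∈ Finset.range (N + 1), f i l * (V l + (1 - e) * Y l) = W i := by
    intro i
    refine Finset.sum_congr rfl fun l _ => ?_
    rw [mul_add, ← mul_assoc, mul_sub, hfe]
    simp
  have hGW : ∀ j ≤ N, ∑ i ∈ Finset.range (j + 1), g (j - i) * W i = if j = N then X else 0 := by
    intro j hj
    rw [← hKY j hj]
    have : ∀ k ∈ Finset.range (N + 1), K j k * Y k = ∑ i ∈ Finset.range (j + 1),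
        ∑ l ∈ Finset.range (N + 1),
          g (j - i) * (f i l * if l ≤ k then g' (k - l) * Y k else 0) := by
      intro k hk
      rw [hK j hj k (Nat.lt_succ_iff.1 (Finset.mem_range.1 hk)), Finset.sum_mul]
      refine Finset.sum_congr rfl fun i _ => ?_
      rw [sum_range_succ_eq_sum_ite (Finset.mem_range.1 hk), Finset.sum_mul]
      refine Finset.sum_congr rfl fun l _ => ?_
      split_ifs <;> simp [mul_assoc]
    rw [Finset.sum_congr rfl this, Finset.sum_comm]
    refine Finset.sum_congr rfl fun i _ => ?_
    rw [Finset.sum_comm, hW]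
    simp only [hV, Finset.mul_sum]
  have heW : ∀ i, e * W i = W i := by
    intro i
    simp only [hW, Finset.mul_sum, ← mul_assoc, hef]
  have hW0 : ∀ j, j ≤ N → W j = if j = N then X else 0 := by
    intro j
    induction j using Nat.strong_induction_on with
    | _ j ih =>
      intro hj
      rw [← hGW j hj, Finset.sum_range_succ, Finset.sum_eq_zero]
      · simp [hg, heW]
      · intro i hi
        have hi' := Finset.mem_range.1 hi
        rw [ih i hi' (by omega), if_neg (by omega), mul_zero]
  refine ⟨fun l => V l + (1 - e) * Y l, ?_, fun j hj => ?_⟩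
  · have : V N = e := by
      simp only [hV]
      rw [Finset.sum_eq_single N]
      · simp [hg', hY]
      · intro k hk hkN
        have := Finset.mem_range.1 hk
        rw [if_neg (by omega)]
      · simp
    simp only [this, hY]
    simp
  · rw [hWV, hW0 j hj]

/-- Prepend a zero block to the column; the corner and the first block column of `K` then play no
role. -/
theorem IsLastSchurBlock.cons {N : ℕ} {f K : ℕ → ℕ → Matrix (Fin q) (Fin q) ℂ}
    {X : Matrix (Fin q) (Fin q) ℂ}
    (hK0 : ∀ k, K 0 (k + 1) = 0)
    (hK : ∀ j k, K (j + 1) (k + 1) = f j k) (hX : IsLastSchurBlock f N X) :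
    IsLastSchurBlock K (N + 1) X := by
  obtain ⟨Y, hY, h⟩ := hX
  refine ⟨fun k => k.casesOn 0 Y, hY, fun j hj => ?_⟩
  rw [Finset.sum_range_succ']
  rcases j with _ | j
  · simp [hK0]
  · simp [hK, h j (by omega)]

open scoped MatrixOrder in
theorem exists_eq_conjTranspose_mul_self {m : Type*} [Fintype m] [DecidableEq m]
    {M : Matrix m m ℂ} (hM : M.PosSemidef) : ∃ D : Matrix m m ℂ, M = Dᴴ * D :=
  CStarAlgebra.nonneg_iff_eq_star_mul_self.1 hM.nonneg

/-- For a non-negative Hermitian block matrix, `A * A† * B = B` for the leading block `A` and the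
upper right block `B`. -/
theorem mul_mpInv_mul_of_posSemidef {m n k : Type*} [Fintype m] [Fintype n] [Fintype k]
    [DecidableEq m] [DecidableEq n] [DecidableEq k] {M : Matrix m m ℂ} (hM : M.PosSemidef)
    (φ : n → m) (ψ : k → m) :
    M.submatrix φ φ * mpInv (M.submatrix φ φ) * M.submatrix φ ψ = M.submatrix φ ψ := by
  obtain ⟨D, rfl⟩ := exists_eq_conjTranspose_mul_self hM
  set D₁ := D.submatrix id φ with hD₁
  set D₂ := D.submatrix id ψ with hD₂
  have h1 : (Dᴴ * D).submatrix φ φ = D₁ᴴ * D₁ := by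
    rw [← submatrix_mul_equiv _ _ _ (Equiv.refl m)]; rfl
  have h2 : (Dᴴ * D).submatrix φ ψ = D₁ᴴ * D₂ := by
    rw [← submatrix_mul_equiv _ _ _ (Equiv.refl m)]; rfl
  rw [h1, h2]
  set A := D₁ᴴ * D₁ with hA
  have hp := mpInv_spec A
  -- The difference of the two sides times its adjoint vanishes, because multiplying it by `D₁`
  -- gives `A A† A - A`.
  have h3 : A * mpInv A * D₁ᴴ = D₁ᴴ := by
    rw [← sub_eq_zero, ← Matrix.self_mul_conjTranspose_eq_zero]
    have : (A * mpInv A * D₁ᴴ - D₁ᴴ)ᴴ = D₁ * (A * mpInv A - 1) := by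
      rw [conjTranspose_sub, conjTranspose_mul, hp.hermitian_left, conjTranspose_conjTranspose,
        Matrix.mul_sub, Matrix.mul_one]
    rw [this, ← Matrix.mul_assoc, Matrix.sub_mul, Matrix.mul_assoc (A * mpInv A), ← hA,
      hp.mul_mul_left, sub_self, Matrix.zero_mul]
  rw [← Matrix.mul_assoc, h3]

/-- The witness is the column with upper part `-A† B` and last block `1`. Its upper image vanishes
because non-negativity gives `A A† B = B`. -/
theorem isLastSchurBlock_schurCompl {s : ℕ → Matrix (Fin q) (Fin q) ℂ} {n : ℕ}
    (h : HankelNonneg n s) :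
    IsLastSchurBlock (fun j k => s (j + k)) n (schurCompl s n) := by
  rcases n with _ | n
  · exact ⟨fun _ => 1, rfl, fun j hj => by obtain rfl : j = 0 := by omega
                                           simp [schurCompl]⟩
  set A := blockHankel s n with hA
  set B := blockCol s (n + 1) (n + 1) with hB
  set Z := mpInv A * B with hZ
  have hAZ : A * Z = B := by
    have := mul_mpInv_mul_of_posSemidef h (fun a : Fin (n + 1) × Fin q => (a.1.castSucc, a.2))
      (fun x : Fin q => (Fin.last (n + 1), x))
    have hB' : (blockHankel s (n + 1)).submatrix
        (fun a : Fin (n + 1) × Fin q => (a.1.castSucc, a.2))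
        (fun x : Fin q => (Fin.last (n + 1), x)) = B := by
      ext a y
      simp [hB, blockCol, blockHankel, add_comm]
    have hA' : (blockHankel s (n + 1)).submatrix
        (fun a : Fin (n + 1) × Fin q => (a.1.castSucc, a.2))
        (fun a : Fin (n + 1) × Fin q => (a.1.castSucc, a.2)) = A := by
      ext a b
      simp [hA, blockHankel]
    rw [hZ, ← Matrix.mul_assoc]
    rwa [hA', hB'] at this
  set Y : ℕ → Matrix (Fin q) (Fin q) ℂ := fun k =>
    if h : k < n + 1 then fun x y => -Z (⟨k, h⟩, x) y else 1 with hY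
  have hsum : ∀ f : ℕ → Matrix (Fin q) (Fin q) ℂ, ∑ k ∈ Finset.range (n + 1), f k * Y k =
      -((Matrix.of fun i b => f b.1 i b.2 : Matrix (Fin q) (Fin (n + 1) × Fin q) ℂ) * Z) := by
    intro f
    ext x y
    have hY' : ∀ (k : Fin (n + 1)) (i : Fin q), Y k i y = -Z (k, i) y := by
      intro k i
      have h1 : Y k = Matrix.of fun x y => -Z (k, x) y := dif_pos k.2
      rw [h1]
      rfl
    simp [hY', Matrix.mul_apply, Fintype.sum_prod_type, Finset.sum_range, Matrix.sum_apply]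
  have hYn : Y (n + 1) = 1 := by simp [hY]
  refine ⟨Y, hYn, fun j hj => ?_⟩
  rw [Finset.sum_range_succ, hYn, hsum]
  split_ifs with hjn
  · subst hjn
    rw [schurCompl, Matrix.mul_assoc, ← hA, ← hB, ← hZ, mul_one, neg_add_eq_sub, two_mul]
    rfl
  · have hj' : j < n + 1 := by omega
    ext x y
    have h1 : ∑ b : Fin (n + 1) × Fin q, s (j + b.1) x b.2 * Z b y = s (n + 1 + j) x y :=
      congrFun (congrFun hAZ (⟨j, hj'⟩, x)) y
    simp only [Matrix.mul_apply, Matrix.add_apply, Matrix.neg_apply, mul_one, Matrix.of_apply, h1,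
      Matrix.zero_apply, add_comm j (n + 1), neg_add_cancel]

theorem schurCompl_sub_congr {s s' : ℕ → Matrix (Fin q) (Fin q) ℂ} {n : ℕ}
    (h : ∀ j < 2 * n, s j = s' j) :
    schurCompl s n - s (2 * n) = schurCompl s' n - s' (2 * n) := by
  rcases n with _ | n
  · simp [schurCompl]
  · have h1 : blockHankel s n = blockHankel s' n := by
      ext a b
      simp only [blockHankel]
      rw [h _ (by omega)]
    have h2 : blockRow s (n + 1) (n + 1) = blockRow s' (n + 1) (n + 1) := by
      ext a b
      simp only [blockRow]
      rw [h _ (by omega)]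
    have h3 : blockCol s (n + 1) (n + 1) = blockCol s' (n + 1) (n + 1) := by
      ext a b
      simp only [blockCol]
      rw [h _ (by omega)]
    simp [schurCompl, h1, h2, h3]

end SchurComplement

/-! ### Reciprocal sequences as inverses in a corner -/

section Reciprocal

variable {q : ℕ}

theorem mpInv_conjTranspose_of_isHermitian {A : Matrix (Fin q) (Fin q) ℂ} (hA : Aᴴ = A) :
    (mpInv A)ᴴ = mpInv A := by
  have h := mpInv_spec A
  have h1 : (mpInv A)ᴴ * A = A * mpInv A := by
    rw [← h.hermitian_left, conjTranspose_mul, hA]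
  have h2 : A * (mpInv A)ᴴ = mpInv A * A := by
    rw [← h.hermitian_right, conjTranspose_mul, hA]
  refine IsMoorePenrose.unique (A := A) ⟨?_, ?_, ?_, ?_⟩ h
  · rw [Matrix.mul_assoc, h1, ← h.hermitian_left]
    nth_rw 1 [← hA]
    rw [← conjTranspose_mul, h.mul_mul_left, hA]
  · rw [Matrix.mul_assoc, h2, ← h.hermitian_right, ← conjTranspose_mul, h.mul_mul_right]
  · rw [h2, h.hermitian_right]
  · rw [h1, h.hermitian_left]

theorem mpInv_mul_comm_of_isHermitian {A : Matrix (Fin q) (Fin q) ℂ} (hA : Aᴴ = A) :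
    mpInv A * A = A * mpInv A := by
  rw [← (mpInv_spec A).hermitian_left, conjTranspose_mul, hA,
    mpInv_conjTranspose_of_isHermitian hA]

theorem mpInv_mul_self_mul_mpInv (A : Matrix (Fin q) (Fin q) ℂ) :
    mpInv A * (A * mpInv A) = mpInv A := by
  rw [← Matrix.mul_assoc, (mpInv_spec A).mul_mul_right]

theorem recipSeq_zero (u : ℕ → Matrix (Fin q) (Fin q) ℂ) : recipSeq u 0 = mpInv (u 0) := by
  rw [recipSeq]

theorem recipSeq_succ (u : ℕ → Matrix (Fin q) (Fin q) ℂ) (j : ℕ) :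
    recipSeq u (j + 1) =
      -(mpInv (u 0) * ∑ l ∈ Finset.range (j + 1), u (j + 1 - l) * recipSeq u l) := by
  rw [recipSeq, Finset.sum_range]

theorem proj_mul_mpInv {A : Matrix (Fin q) (Fin q) ℂ} (hA : Aᴴ = A) :
    A * mpInv A * mpInv A = mpInv A := by
  rw [← mpInv_mul_comm_of_isHermitian hA, (mpInv_spec A).mul_mul_right]

theorem proj_mul_recipSeq {u : ℕ → Matrix (Fin q) (Fin q) ℂ} (hu : (u 0)ᴴ = u 0) (j : ℕ) :
    u 0 * mpInv (u 0) * recipSeq u j = recipSeq u j := by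
  rcases j with _ | j
  · rw [recipSeq_zero, proj_mul_mpInv hu]
  · rw [recipSeq_succ, mul_neg, ← mul_assoc, proj_mul_mpInv hu]

/-- The reciprocal sequence depends only on the compressions of the `u j` to the range
of `u 0`. -/
theorem recipSeq_eq_of_compression_eq {u u' : ℕ → Matrix (Fin q) (Fin q) ℂ}
    (hu : (u 0)ᴴ = u 0) (h0 : u' 0 = u 0) {j : ℕ}
    (h : ∀ i ≤ j, u 0 * mpInv (u 0) * u' i * (u 0 * mpInv (u 0)) =
      u 0 * mpInv (u 0) * u i * (u 0 * mpInv (u 0))) :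
    recipSeq u' j = recipSeq u j := by
  induction j using Nat.strong_induction_on with
  | _ j ih =>
    rcases j with _ | j
    · rw [recipSeq_zero, recipSeq_zero, h0]
    · rw [recipSeq_succ, recipSeq_succ, h0]
      congr 1
      rw [Finset.mul_sum, Finset.mul_sum]
      refine Finset.sum_congr rfl fun l hl => ?_
      have hl' := Finset.mem_range.1 hl
      rw [ih l hl' fun i hi => h i (by omega)]
      -- Both neighbours of `x` absorb the projection `u 0 * mpInv (u 0)`, so only the compression
      -- of `x` enters.
      have key : ∀ x, mpInv (u 0) * (x * recipSeq u l) =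
          mpInv (u 0) * (u 0 * mpInv (u 0) * x * (u 0 * mpInv (u 0))) * recipSeq u l := by
        intro x
        conv_lhs => rw [← proj_mul_recipSeq hu l]
        simp only [← mul_assoc, (mpInv_spec (u 0)).mul_mul_right]
      rw [key, key, h _ (by omega)]

open PowerSeries

/-- Multiplying the recursion by `u 0` turns its prefactor into the projection, which the `u j`
absorb. -/
theorem mk_mul_mk_recipSeq {u : ℕ → Matrix (Fin q) (Fin q) ℂ}
    (hu : ∀ j, u 0 * mpInv (u 0) * u j = u j) :
    (mk u * mk (recipSeq u) : (Matrix (Fin q) (Fin q) ℂ)⟦X⟧) = C (u 0 * mpInv (u 0)) := by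
  ext1 j
  rw [coeff_mul]
  simp only [coeff_mk]
  rcases j with _ | j
  · simp [recipSeq_zero]
  · rw [← Finset.Nat.sum_antidiagonal_swap]
    simp only [Prod.fst_swap, Prod.snd_swap]
    rw [Finset.Nat.sum_antidiagonal_eq_sum_range_succ_mk, Finset.sum_range_succ]
    simp only [Nat.sub_self]
    rw [recipSeq_succ, mul_neg, ← mul_assoc, Finset.mul_sum]
    simp only [← mul_assoc, hu]
    simp

/-- The adjoint sequence is a left inverse of `u` in the corner and `recipSeq u` a right inverse, so
they coincide. -/
theorem recipSeq_conjTranspose {u : ℕ → Matrix (Fin q) (Fin q) ℂ}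
    (hu : ∀ j, u 0 * mpInv (u 0) * u j = u j) (hh : ∀ j, (u j)ᴴ = u j) (j : ℕ) :
    (recipSeq u j)ᴴ = recipSeq u j := by
  have h1 := mk_mul_mk_recipSeq hu
  have h2 : (mk (fun j => (recipSeq u j)ᴴ) * mk u : (Matrix (Fin q) (Fin q) ℂ)⟦X⟧) =
      C (u 0 * mpInv (u 0)) := by
    ext1 j
    have := congrArg conjTranspose (congrArg (coeff j) h1)
    rw [coeff_mul, conjTranspose_sum] at this
    simp only [coeff_mk, conjTranspose_mul, hh] at this
    rw [coeff_mul, ← Finset.Nat.sum_antidiagonal_swap]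
    simp only [Prod.fst_swap, Prod.snd_swap, coeff_mk]
    rw [this, coeff_C]
    split_ifs
    · exact (mpInv_spec (u 0)).hermitian_left
    · simp
  have h3 : (mk (fun j => (recipSeq u j)ᴴ) : (Matrix (Fin q) (Fin q) ℂ)⟦X⟧) *
      C (u 0 * mpInv (u 0)) = mk (fun j => (recipSeq u j)ᴴ) := by
    ext1 j
    rw [coeff_mul_C, coeff_mk, ← (mpInv_spec (u 0)).hermitian_left, ← conjTranspose_mul,
      proj_mul_recipSeq (hh 0)]
  have h4 : (C (u 0 * mpInv (u 0)) * mk (recipSeq u) : (Matrix (Fin q) (Fin q) ℂ)⟦X⟧) =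
      mk (recipSeq u) := by
    ext1 j
    rw [coeff_C_mul, coeff_mk, proj_mul_recipSeq (hh 0)]
  have h5 : (mk (fun j => (recipSeq u j)ᴴ) : (Matrix (Fin q) (Fin q) ℂ)⟦X⟧) =
      mk (recipSeq u) := by
    rw [← h3, ← h1, ← mul_assoc, h2, h4]
  simpa using congrArg (coeff j) h5

theorem mk_recipSeq_mul_mk {u : ℕ → Matrix (Fin q) (Fin q) ℂ}
    (hu : ∀ j, u 0 * mpInv (u 0) * u j = u j) (hh : ∀ j, (u j)ᴴ = u j) :
    (mk (recipSeq u) * mk u : (Matrix (Fin q) (Fin q) ℂ)⟦X⟧) = C (u 0 * mpInv (u 0)) := by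
  have h1 := mk_mul_mk_recipSeq hu
  ext1 j
  have := congrArg conjTranspose (congrArg (coeff j) h1)
  rw [coeff_mul, conjTranspose_sum] at this
  simp only [coeff_mk, conjTranspose_mul, hh, recipSeq_conjTranspose hu hh] at this
  rw [coeff_mul, ← Finset.Nat.sum_antidiagonal_swap]
  simp only [Prod.fst_swap, Prod.snd_swap, coeff_mk]
  rw [this, coeff_C]
  split_ifs
  · exact (mpInv_spec (u 0)).hermitian_left
  · simp

end Reciprocal

/-! ### Congruences and Schur complements for compressed sequences -/

section CompressedSequence

open PowerSeries

variable {q : ℕ} {s : ℕ → Matrix (Fin q) (Fin q) ℂ} {α : ℝ}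

theorem C_smul {R : Type*} [Ring R] [Algebra ℂ R] (c : ℂ) (x : R) :
    (C (c • x) : R⟦X⟧) = c • C x := by
  ext j
  rw [coeff_smul, coeff_C, coeff_C]
  split_ifs <;> simp

theorem plusTransform_zero (c : ℂ) (s : ℕ → Matrix (Fin q) (Fin q) ℂ) :
    plusTransform c s 0 = s 0 := by
  rw [plusTransform]

theorem mk_plusTransform (c : ℂ) (s : ℕ → Matrix (Fin q) (Fin q) ℂ) :
    (mk (plusTransform c s) : (Matrix (Fin q) (Fin q) ℂ)⟦X⟧) = mk s - c • (X * mk s) := by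
  ext1 j
  rcases j with _ | j
  · simp [plusTransform]
  · simp only [coeff_mk, map_sub, coeff_smul, coeff_succ_X_mul, plusTransform]
    abel

theorem mk_plusTransform_eq_add (c : ℂ) (s : ℕ → Matrix (Fin q) (Fin q) ℂ) :
    (mk (plusTransform c s) : (Matrix (Fin q) (Fin q) ℂ)⟦X⟧) =
      C (s 0) + X * mk (rightShift c s) := by
  ext1 j
  rcases j with _ | j
  · simp [plusTransform]
  · simp [plusTransform, coeff_succ_X_mul, rightShift]

theorem X_mul_mk_rightShift (c : ℂ) (t : ℕ → Matrix (Fin q) (Fin q) ℂ) :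
    (X * mk (rightShift c t) : (Matrix (Fin q) (Fin q) ℂ)⟦X⟧) =
      mk t - C (t 0) - c • (X * mk t) := by
  have h1 := mk_plusTransform_eq_add c t
  have h2 := mk_plusTransform c t
  rw [h1] at h2
  rw [← add_right_inj (C (t 0)), h2]
  abel

theorem X_mul_mk_schurTransform (c : ℂ) (s : ℕ → Matrix (Fin q) (Fin q) ℂ) :
    (X * mk (schurTransform c s) : (Matrix (Fin q) (Fin q) ℂ)⟦X⟧) =
      C (s 0) - C (s 0) * mk (recipSeq (plusTransform c s)) * C (s 0) := by
  ext1 j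
  rw [map_sub, coeff_mul_C, coeff_C_mul]
  rcases j with _ | j
  · simp [recipSeq_zero, plusTransform, (mpInv_spec (s 0)).mul_mul_left]
  · simp [coeff_succ_X_mul, schurTransform]

theorem plusTransform_conjTranspose (hs : ∀ j, (s j)ᴴ = s j) (j : ℕ) :
    (plusTransform (α : ℂ) s j)ᴴ = plusTransform (α : ℂ) s j := by
  rcases j with _ | j <;> simp [plusTransform, hs]

theorem proj_mul_plusTransform (hes : ∀ j, s 0 * mpInv (s 0) * s j = s j) (j : ℕ) :
    plusTransform (α : ℂ) s 0 * mpInv (plusTransform (α : ℂ) s 0) * plusTransform (α : ℂ) s j =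
      plusTransform (α : ℂ) s j := by
  rw [plusTransform_zero]
  rcases j with _ | j <;> simp [plusTransform, hes, mul_add]

theorem proj_mul_schurTransform (j : ℕ) :
    s 0 * mpInv (s 0) * schurTransform (α : ℂ) s j = schurTransform (α : ℂ) s j := by
  simp only [schurTransform, ← mul_assoc, (mpInv_spec (s 0)).mul_mul_left]

theorem mul_proj_of_proj_mul {A B : Matrix (Fin q) (Fin q) ℂ} (hB : Bᴴ = B)
    (h : A * mpInv A * B = B) : B * (A * mpInv A) = B := by
  rw [← hB, ← (mpInv_spec A).hermitian_left, ← conjTranspose_mul, h]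

/-- The Hankel matrix of the Schur transform in terms of the Hankel matrix of the shifted
sequence. -/
theorem schurTransform_hankel_factorization (hs : ∀ j, (s j)ᴴ = s j)
    (hes : ∀ j, s 0 * mpInv (s 0) * s j = s j) (j k : ℕ) :
    schurTransform (α : ℂ) s (j + k) =
      ∑ i ∈ Finset.range (j + 1), ∑ l ∈ Finset.range (k + 1),
        s 0 * recipSeq (plusTransform (α : ℂ) s) (j - i) * rightShift (α : ℂ) s (i + l) *
          (s 0 * recipSeq (plusTransform (α : ℂ) s) (k - l))ᴴ := by
  set u := plusTransform (α : ℂ) s with hu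
  have hu0 : u 0 = s 0 := plusTransform_zero _ s
  have hh := plusTransform_conjTranspose (α := α) hs
  have hproj : ∀ j, u 0 * mpInv (u 0) * u j = u j := proj_mul_plusTransform hes
  have hr := recipSeq_conjTranspose hproj hh
  have hse : ∀ j, s j * (s 0 * mpInv (s 0)) = s j := fun j => mul_proj_of_proj_mul (hs j) (hes j)
  have h1 : (mk u * mk (recipSeq u) : (Matrix (Fin q) (Fin q) ℂ)⟦X⟧) = C (s 0 * mpInv (s 0)) := by
    rw [← hu0]
    exact mk_mul_mk_recipSeq hproj
  have h2 : (mk (recipSeq u) * mk u : (Matrix (Fin q) (Fin q) ℂ)⟦X⟧) = C (s 0 * mpInv (s 0)) := by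
    rw [← hu0]
    exact mk_recipSeq_mul_mk hproj hh
  rw [hu, mk_plusTransform_eq_add, ← hu] at h1 h2
  have := mul_hankelColumn_of_schur (t := schurTransform (α : ℂ) s)
    (mpInv_mul_comm_of_isHermitian (hs 0)) rfl (hse 0)
    (by ext1 j; rw [coeff_C_mul, coeff_mk, ← hu0]; exact proj_mul_recipSeq (hh 0) j)
    (fun j => by simp [rightShift, add_mul, hse]) proj_mul_schurTransform h1 h2
    (X_mul_mk_schurTransform _ s) (by rw [coeff_mk, recipSeq_zero, hu0]) k
  have h3 := congrArg (coeff j) this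
  rw [coeff_mul_hankelColumn, coeff_mk] at h3
  rw [← h3]
  simp only [coeff_C_mul, coeff_mul_C, coeff_mk, conjTranspose_mul, hs, hr]

/-- The Taylor coefficients of `s₀ S(z)⁻¹`, where `S` is the generating function of `s`. -/
noncomputable def recipFactor (c : ℂ) (s : ℕ → Matrix (Fin q) (Fin q) ℂ) (j : ℕ) :
    Matrix (Fin q) (Fin q) ℂ :=
  s 0 * plusTransform c (recipSeq (plusTransform c s)) j

theorem recipFactor_conjTranspose (hs : ∀ j, (s j)ᴴ = s j)
    (hes : ∀ j, s 0 * mpInv (s 0) * s j = s j) (j : ℕ) :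
    (recipFactor (α : ℂ) s j)ᴴ =
      plusTransform (α : ℂ) (recipSeq (plusTransform (α : ℂ) s)) j * s 0 := by
  have hr := recipSeq_conjTranspose (u := plusTransform (α : ℂ) s) (proj_mul_plusTransform hes)
    (plusTransform_conjTranspose hs)
  rw [recipFactor, conjTranspose_mul, hs, plusTransform_conjTranspose hr]

theorem recipFactor_zero (c : ℂ) : recipFactor c s 0 = s 0 * mpInv (s 0) := by
  simp [recipFactor, plusTransform, recipSeq_zero]

/-- The Hankel matrix of a sequence in terms of its first entry and the Hankel matrix of the
shifted Schur transform. -/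
theorem hankel_factorization (hs : ∀ j, (s j)ᴴ = s j)
    (hes : ∀ j, s 0 * mpInv (s 0) * s j = s j) (j k : ℕ) :
    ∑ i ∈ Finset.range (j + 1), ∑ l ∈ Finset.range (k + 1),
        recipFactor (α : ℂ) s (j - i) * s (i + l) * (recipFactor (α : ℂ) s (k - l))ᴴ =
      k.casesOn (coeff j (C (s 0))) fun k => j.casesOn 0 fun j =>
        rightShift (α : ℂ) (schurTransform (α : ℂ) s) (j + k) := by
  set u := plusTransform (α : ℂ) s with hu
  set r := recipSeq u with hr
  have hu0 : u 0 = s 0 := plusTransform_zero _ s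
  have hh := plusTransform_conjTranspose (α := α) hs
  have hproj : ∀ j, u 0 * mpInv (u 0) * u j = u j := proj_mul_plusTransform hes
  have hse : ∀ j, s j * (s 0 * mpInv (s 0)) = s j := fun j => mul_proj_of_proj_mul (hs j) (hes j)
  have h1 : (mk u * mk r : (Matrix (Fin q) (Fin q) ℂ)⟦X⟧) = C (s 0 * mpInv (s 0)) := by
    rw [← hu0]
    exact mk_mul_mk_recipSeq hproj
  have h2 : (mk r * mk u : (Matrix (Fin q) (Fin q) ℂ)⟦X⟧) = C (s 0 * mpInv (s 0)) := by
    rw [← hu0]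
    exact mk_recipSeq_mul_mk hproj hh
  -- The factor `1 - αz` is central, so it can pass from `u` to `r`; the claim becomes `s₀ r U = s₀
  -- e`.
  have hF : C (s 0) * mk (plusTransform (α : ℂ) r) * mk s = C (s 0) := by
    have : mk (plusTransform (α : ℂ) r) * mk s = mk r * mk u := by
      rw [mk_plusTransform, hu, mk_plusTransform, sub_mul, mul_sub, smul_mul_assoc, mul_smul_comm,
        ← mul_assoc (mk r), (commute_X (mk r)).eq]
    rw [mul_assoc, this, h2, ← map_mul, hse]
  have hF' : mk s * (mk (plusTransform (α : ℂ) r) * C (s 0)) = C (s 0) := by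
    have : mk s * mk (plusTransform (α : ℂ) r) = mk u * mk r := by
      rw [mk_plusTransform, hu, mk_plusTransform, sub_mul, mul_sub, smul_mul_assoc, mul_smul_comm,
        ← mul_assoc (mk s), (commute_X (mk s)).eq]
    rw [← mul_assoc, this, h1, ← map_mul, hes]
  have hb : X * (X * mk (rightShift (α : ℂ) (schurTransform (α : ℂ) s))) =
      C (s 0) - C (s 0) * mk (plusTransform (α : ℂ) r) * C (s 0) -
        X * C ((α : ℂ) • s 0 + schurTransform (α : ℂ) s 0) := by
    rw [X_mul_mk_rightShift, mk_plusTransform, mul_sub, mul_sub, mul_smul_comm,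
      X_mul_mk_schurTransform, ← hu, ← hr, map_add, C_smul, mul_add, mul_smul_comm, mul_sub, mul_sub,
      smul_sub, mul_smul_comm, sub_mul, smul_mul_assoc]
    have : C (s 0) * (X * mk r) * C (s 0) = X * (C (s 0) * mk r * C (s 0)) := by
      rw [← mul_assoc, (commute_X (C (s 0))).eq]
      simp only [mul_assoc]
    rw [this]
    abel
  have key := fun k => mul_hankelColumn_succ_of_schur (hse 0) hF hF'
    (by rw [coeff_mul_C, coeff_mk, plusTransform_zero, hr, recipSeq_zero, hu0]
        exact mpInv_mul_comm_of_isHermitian (hs 0))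
    (mul_assoc _ _ _) hb k
  have h3 : ∀ j k, ∑ i ∈ Finset.range (j + 1), ∑ l ∈ Finset.range (k + 1),
        recipFactor (α : ℂ) s (j - i) * s (i + l) * (recipFactor (α : ℂ) s (k - l))ᴴ =
      coeff j (C (s 0) * mk (plusTransform (α : ℂ) r) *
        hankelColumn s (mk (plusTransform (α : ℂ) r) * C (s 0)) k) := by
    intro j k
    rw [coeff_mul_hankelColumn]
    simp only [recipFactor_conjTranspose hs hes, coeff_C_mul, coeff_mul_C, coeff_mk]
    rfl
  rw [h3]
  rcases k with _ | k
  · rw [(key 0).1]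
    rfl
  · rw [(key k).2]
    rcases j with _ | j
    · simp
    · rw [coeff_succ_X_mul, coeff_mk]

theorem hankelNonneg_schurTransform {n : ℕ} (hs : ∀ j, (s j)ᴴ = s j)
    (hes : ∀ j, s 0 * mpInv (s 0) * s j = s j) (h : HankelNonneg n (rightShift (α : ℂ) s)) :
    HankelNonneg n (schurTransform (α : ℂ) s) :=
  blockMatrix_posSemidef_toeplitz
    (g := fun j => s 0 * recipSeq (plusTransform (α : ℂ) s) j)
    (fun j _ k _ => schurTransform_hankel_factorization hs hes j k) h

/-- Pull the Schur block of the transform back through the Toeplitz congruence and use uniqueness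
for the shifted sequence. -/
theorem schurCompl_schurTransform {n : ℕ} (hs : ∀ j, (s j)ᴴ = s j)
    (hes : ∀ j, s 0 * mpInv (s 0) * s j = s j) (h : HankelNonneg n (rightShift (α : ℂ) s)) :
    schurCompl (schurTransform (α : ℂ) s) n = schurCompl (rightShift (α : ℂ) s) n := by
  have hse : ∀ j, s j * (s 0 * mpInv (s 0)) = s j := fun j => mul_proj_of_proj_mul (hs j) (hes j)
  have h1 := isLastSchurBlock_schurCompl (hankelNonneg_schurTransform hs hes h)
  have h0 : s 0 * recipSeq (plusTransform (α : ℂ) s) 0 = s 0 * mpInv (s 0) := by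
    rw [recipSeq_zero, plusTransform_zero]
  refine IsLastSchurBlock.unique (f := fun j k => rightShift (α : ℂ) s (j + k)) h (h1.of_toeplitz
    (g := fun j => s 0 * recipSeq (plusTransform (α : ℂ) s) j)
    (g' := fun j => (s 0 * recipSeq (plusTransform (α : ℂ) s) j)ᴴ)
    (fun j _ k _ => schurTransform_hankel_factorization hs hes j k) h0 ?_ ?_ ?_)
    (isLastSchurBlock_schurCompl h)
  · rw [h0, (mpInv_spec (s 0)).hermitian_left]
  · intro j k
    simp [rightShift, mul_add, hes]
  · intro j k
    simp [rightShift, add_mul, hse]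

theorem hankelNonneg_rightShift_schurTransform {n : ℕ} (hs : ∀ j, (s j)ᴴ = s j)
    (hes : ∀ j, s 0 * mpInv (s 0) * s j = s j) (h : HankelNonneg (n + 1) s) :
    HankelNonneg n (rightShift (α : ℂ) (schurTransform (α : ℂ) s)) := by
  have h1 := blockMatrix_posSemidef_shift (blockMatrix_posSemidef_toeplitz
    (fun j _ k _ => (hankel_factorization (α := α) hs hes j k).symm) h)
  exact h1

/-- The congruent matrix splits off the block `s 0`, which costs one size: hence `n` against `n +
1`. -/
theorem schurCompl_rightShift_schurTransform {n : ℕ} (hs : ∀ j, (s j)ᴴ = s j)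
    (hes : ∀ j, s 0 * mpInv (s 0) * s j = s j) (h : HankelNonneg (n + 1) s) :
    schurCompl (rightShift (α : ℂ) (schurTransform (α : ℂ) s)) n = schurCompl s (n + 1) := by
  have hse : ∀ j, s j * (s 0 * mpInv (s 0)) = s j := fun j => mul_proj_of_proj_mul (hs j) (hes j)
  have h1 := isLastSchurBlock_schurCompl (hankelNonneg_rightShift_schurTransform (α := α) hs hes h)
  set K : ℕ → ℕ → Matrix (Fin q) (Fin q) ℂ := fun j k =>
    k.casesOn (coeff j (C (s 0))) fun k => j.casesOn 0 fun j =>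
      rightShift (α : ℂ) (schurTransform (α : ℂ) s) (j + k) with hK
  have h2 : IsLastSchurBlock K (n + 1)
      (schurCompl (rightShift (α : ℂ) (schurTransform (α : ℂ) s)) n) :=
    h1.cons (fun k => rfl) (fun j k => rfl)
  have h3 : IsLastSchurBlock (fun j k => s (j + k)) (n + 1)
      (schurCompl (rightShift (α : ℂ) (schurTransform (α : ℂ) s)) n) :=
    h2.of_toeplitz (g := recipFactor (α : ℂ) s) (g' := fun j => (recipFactor (α : ℂ) s j)ᴴ)
      (fun j _ k _ => (hankel_factorization (α := α) hs hes j k).symm) (recipFactor_zero _)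
      (by rw [recipFactor_zero, (mpInv_spec (s 0)).hermitian_left])
      (fun j k => hes (j + k)) (fun j k => hse (j + k))
  exact IsLastSchurBlock.unique (f := fun j k => s (j + k)) h h3 (isLastSchurBlock_schurCompl h)

end CompressedSequence

/-! ### One transform step for a general sequence -/

section SchurStep

variable {q : ℕ} {s : ℕ → Matrix (Fin q) (Fin q) ℂ} {α : ℝ}

theorem HankelNonneg.mono {n n' : ℕ} (h : HankelNonneg n s) (hn : n' ≤ n) :
    HankelNonneg n' s :=
  blockMatrix_posSemidef_mono (f := fun j k => s (j + k)) (Nat.succ_le_succ hn) h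

theorem HankelNonneg.congr {n : ℕ} {s' : ℕ → Matrix (Fin q) (Fin q) ℂ} (h : HankelNonneg n s)
    (hs : ∀ j ≤ 2 * n, s j = s' j) : HankelNonneg n s' := by
  have : blockHankel s n = blockHankel s' n := by
    ext a b
    simp only [blockHankel]
    rw [hs _ (by omega)]
  rwa [HankelNonneg, ← this]

theorem HankelNonneg.conjTranspose_eq {n : ℕ} (h : HankelNonneg n s) {j : ℕ} (hj : j ≤ 2 * n) :
    (s j)ᴴ = s j := by
  have := blockMatrix_apply_conjTranspose (f := fun j k => s (j + k)) (j := j / 2)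
    (k := j - j / 2) h (by omega) (by omega)
  rwa [show j / 2 + (j - j / 2) = j by omega, show j - j / 2 + j / 2 = j by omega] at this

/-- Write `s (i + k) = (E i)ᴴ * E k`. If `E i * P = 0` then `s (2i+2) * P = (E (i+2))ᴴ * E i * P =
0`, hence `E (i+1) * P = 0`. The need for `E (i+2)` stops this at `E (n-1)`, which is why `s (2n)`
is excluded. -/
theorem HankelNonneg.mul_eq_zero {n : ℕ} (h : HankelNonneg n s) {P : Matrix (Fin q) (Fin q) ℂ}
    (hP : s 0 * P = 0) {j : ℕ} (hj : j < 2 * n) : s j * P = 0 := by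
  obtain ⟨D, hD⟩ := exists_eq_conjTranspose_mul_self h
  obtain ⟨E, hE⟩ : ∃ E : ℕ → Matrix (Fin (n + 1) × Fin q) (Fin q) ℂ,
      ∀ i ≤ n, ∀ k ≤ n, s (i + k) = (E i)ᴴ * E k := by
    -- `Fin.ofNat` wraps around above `n`, where the values of `E` are irrelevant.
    refine ⟨fun i => D.submatrix id fun x => (Fin.ofNat (n + 1) i, x), fun i hi k hk => ?_⟩
    ext x y
    have := congrFun (congrFun hD (Fin.ofNat (n + 1) i, x)) (Fin.ofNat (n + 1) k, y)
    simp only [blockHankel, Fin.val_ofNat, Nat.mod_eq_of_lt (Nat.lt_succ_of_le hi),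
      Nat.mod_eq_of_lt (Nat.lt_succ_of_le hk)] at this
    rw [this]
    rfl
  have hz : ∀ i ≤ n, s (i + i) * P = 0 → E i * P = 0 := by
    intro i hi h0
    rw [← Matrix.conjTranspose_mul_self_eq_zero, conjTranspose_mul, Matrix.mul_assoc,
      ← Matrix.mul_assoc (E i)ᴴ, ← hE i hi i hi, h0, Matrix.mul_zero]
  have hEP : ∀ i < n, E i * P = 0 := by
    intro i
    induction i with
    | zero => exact fun _ => hz 0 (Nat.zero_le _) hP
    | succ i ih =>
      intro hi
      refine hz _ hi.le ?_
      rw [show i + 1 + (i + 1) = i + 2 + i by ring, hE (i + 2) (by omega) i (by omega),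
        Matrix.mul_assoc, ih (by omega), Matrix.mul_zero]
  obtain ⟨i, k, hi, hk, rfl⟩ : ∃ i k, i ≤ n ∧ k < n ∧ j = i + k :=
    ⟨min j n, j - min j n, by omega, by omega, by omega⟩
  rw [hE i hi k hk.le, Matrix.mul_assoc, hEP k hk, Matrix.mul_zero]

theorem StieltjesNonneg.hankel {m n : ℕ} (h : StieltjesNonneg α m s) (hn : 2 * n ≤ m) :
    HankelNonneg n s := by
  rcases Nat.even_or_odd' m with ⟨l, rfl | rfl⟩
  · exact (h.1 l rfl).1.mono (by omega)
  · exact (h.2 l rfl).1.mono (by omega)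

theorem StieltjesNonneg.hankel_rightShift {m n : ℕ} (h : StieltjesNonneg α m s)
    (hn : 2 * n + 1 ≤ m) : HankelNonneg n (rightShift (α : ℂ) s) := by
  rcases Nat.even_or_odd' m with ⟨l, rfl | rfl⟩
  · exact ((h.1 l rfl).2 (by omega)).mono (by omega)
  · exact (h.2 l rfl).2.mono (by omega)

theorem StieltjesNonneg.of_hankel {m : ℕ} (h : ∀ n, 2 * n ≤ m → HankelNonneg n s)
    (h' : ∀ n, 2 * n + 1 ≤ m → HankelNonneg n (rightShift (α : ℂ) s)) :
    StieltjesNonneg α m s :=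
  ⟨fun n hn => ⟨h n hn.ge, fun h1 => h' (n - 1) (by omega)⟩,
    fun n hn => ⟨h n (by omega), h' n hn.ge⟩⟩

theorem rightShift_congr {s' : ℕ → Matrix (Fin q) (Fin q) ℂ} {m : ℕ} (c : ℂ)
    (h : ∀ j ≤ m, s j = s' j) {j : ℕ} (hj : j < m) : rightShift c s j = rightShift c s' j := by
  rw [rightShift, rightShift, h j hj.le, h (j + 1) hj]

theorem StieltjesNonneg.congr {m : ℕ} {s' : ℕ → Matrix (Fin q) (Fin q) ℂ}
    (h : StieltjesNonneg α m s) (hs : ∀ j ≤ m, s j = s' j) : StieltjesNonneg α m s' :=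
  .of_hankel (fun _ hn => (h.hankel hn).congr fun j hj => hs j (hj.trans hn))
    fun _ hn => (h.hankel_rightShift hn).congr fun _ hj =>
      rightShift_congr _ hs (by omega)

theorem StieltjesNonneg.conjTranspose_eq {m : ℕ} (h : StieltjesNonneg α m s) {j : ℕ}
    (hj : j ≤ m) : (s j)ᴴ = s j := by
  rcases Nat.even_or_odd' j with ⟨l, rfl | rfl⟩
  · exact (h.hankel hj).conjTranspose_eq le_rfl
  · have h1 := (h.hankel_rightShift hj).conjTranspose_eq le_rfl
    have h2 := (h.hankel (n := l) (by omega)).conjTranspose_eq le_rfl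
    simpa [rightShift, h2] using h1

theorem StieltjesNonneg.mul_proj {m : ℕ} (h : StieltjesNonneg α m s) {j : ℕ} (hj : j < m) :
    s j * (s 0 * mpInv (s 0)) = s j := by
  have hP : s 0 * (1 - s 0 * mpInv (s 0)) = 0 := by
    rw [← mpInv_mul_comm_of_isHermitian (h.conjTranspose_eq (Nat.zero_le m)), mul_sub, mul_one,
      ← mul_assoc, (mpInv_spec (s 0)).mul_mul_left, sub_self]
  suffices hj0 : s j * (1 - s 0 * mpInv (s 0)) = 0 by
    rw [mul_sub, mul_one, sub_eq_zero] at hj0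
    exact hj0.symm
  rcases Nat.even_or_odd' m with ⟨n, rfl | rfl⟩
  · exact (h.hankel le_rfl).mul_eq_zero hP hj
  · have hlt : ∀ i < 2 * n, s i * (1 - s 0 * mpInv (s 0)) = 0 := fun i hi =>
      (h.hankel (n := n) (by omega)).mul_eq_zero hP hi
    rcases Nat.lt_or_ge j (2 * n) with hj' | hj'
    · exact hlt j hj'
    · obtain rfl : j = 2 * n := by omega
      rcases n with _ | n
      · exact hP
      -- The top even entry is out of reach of the Hankel matrix of `s`; it is reached through the
      -- last off-diagonal entry of the shifted one.
      · have h1 := (h.hankel_rightShift le_rfl).mul_eq_zero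
          (P := 1 - s 0 * mpInv (s 0)) (j := 2 * n + 1)
          (by simp only [rightShift, add_mul, neg_mul, smul_mul_assoc, hP,
                hlt (0 + 1) (by omega)]; simp) (by omega)
        simpa only [rightShift, add_mul, neg_mul, smul_mul_assoc, hlt (2 * n + 1) (by omega),
          smul_zero, neg_zero, zero_add, mul_add_one, add_assoc, Nat.reduceAdd] using h1

theorem StieltjesNonneg.proj_mul {m : ℕ} (h : StieltjesNonneg α m s) {j : ℕ} (hj : j < m) :
    s 0 * mpInv (s 0) * s j = s j := by
  have h1 := h.mul_proj hj
  rw [← h.conjTranspose_eq hj.le, ← (mpInv_spec (s 0)).hermitian_left, ← conjTranspose_mul, h1]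

/-- Each parameter is its newest entry plus a function of the earlier ones, so changing that entry
changes the parameter by the same amount. The defect term arises this way. -/
theorem stieltjesParam_sub_congr {s' : ℕ → Matrix (Fin q) (Fin q) ℂ} (c : ℂ) {j : ℕ}
    (h : ∀ i < j, s i = s' i) :
    stieltjesParam c s j - s j = stieltjesParam c s' j - s' j := by
  rcases Nat.even_or_odd' j with ⟨n, rfl | rfl⟩
  · simpa [stieltjesParam] using schurCompl_sub_congr h
  · have h1 := schurCompl_sub_congr (s := rightShift c s) (s' := rightShift c s') (n := n)
      fun i hi => by rw [rightShift, rightShift, h i (by omega), h (i + 1) (by omega)]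
    have h2 : (2 * n + 1) / 2 = n := by omega
    simp only [stieltjesParam, Nat.not_even_bit1, if_false, h2]
    rw [show rightShift c s (2 * n) = -(c • s (2 * n)) + s (2 * n + 1) from rfl,
      show rightShift c s' (2 * n) = -(c • s' (2 * n)) + s' (2 * n + 1) from rfl,
      h (2 * n) (by omega), sub_add_eq_sub_sub_swap, sub_add_eq_sub_sub_swap, sub_left_inj] at h1
    exact h1

theorem stieltjesParam_congr {s' : ℕ → Matrix (Fin q) (Fin q) ℂ} (c : ℂ) {j : ℕ}
    (h : ∀ i ≤ j, s i = s' i) : stieltjesParam c s j = stieltjesParam c s' j := by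
  have := stieltjesParam_sub_congr c fun i hi => h i (Nat.le_of_lt hi)
  rwa [h j le_rfl, sub_left_inj] at this

theorem StieltjesNonneg.schurTransform_of_compressed {m : ℕ} (h : StieltjesNonneg α (m + 1) s)
    (hs : ∀ j, (s j)ᴴ = s j) (hes : ∀ j, s 0 * mpInv (s 0) * s j = s j) :
    StieltjesNonneg α m (schurTransform (α : ℂ) s) ∧
      ∀ j ≤ m, stieltjesParam (α : ℂ) (schurTransform (α : ℂ) s) j =
        stieltjesParam (α : ℂ) s (j + 1) := by
  refine ⟨.of_hankel (fun n hn => ?_) (fun n hn => ?_), fun j hj => ?_⟩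
  · exact hankelNonneg_schurTransform hs hes (h.hankel_rightShift (by omega))
  · exact hankelNonneg_rightShift_schurTransform hs hes (h.hankel (by omega))
  · rcases Nat.even_or_odd' j with ⟨n, rfl | rfl⟩
    · have h2 : (2 * n + 1) / 2 = n := by omega
      simpa [stieltjesParam, h2] using
        schurCompl_schurTransform hs hes (h.hankel_rightShift (by omega))
    · have h2 : (2 * n + 1) / 2 = n := by omega
      have h3 : (2 * n + 1 + 1) / 2 = n + 1 := by omega
      have h4 : Even (2 * n + 1 + 1) := ⟨n + 1, by ring⟩
      simp only [stieltjesParam, Nat.not_even_bit1, if_false, h2, h3, h4, if_true]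
      exact schurCompl_rightShift_schurTransform hs hes (h.hankel (by omega))

/-- The compression of `s 0, …, s m` to the range of `s 0`, continued by zero. -/
noncomputable def compression (s : ℕ → Matrix (Fin q) (Fin q) ℂ) (m : ℕ) (j : ℕ) :
    Matrix (Fin q) (Fin q) ℂ :=
  if j ≤ m then s 0 * mpInv (s 0) * s j * (s 0 * mpInv (s 0)) else 0

theorem HankelNonneg.compress {n : ℕ} (h : HankelNonneg n s) (E : Matrix (Fin q) (Fin q) ℂ) :
    HankelNonneg n fun j => E * s j * Eᴴ := by
  refine blockMatrix_posSemidef_toeplitz (f := fun j k => s (j + k))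
    (K := fun j k => E * s (j + k) * Eᴴ) (g := fun j => if j = 0 then E else 0) (fun j _ k _ => ?_) h
  rw [Finset.sum_range_succ, Finset.sum_eq_zero, Finset.sum_range_succ, Finset.sum_eq_zero]
  · simp
  · intro l hl
    have := Finset.mem_range.1 hl
    simp [show k - l ≠ 0 by omega]
  · intro i hi
    have := Finset.mem_range.1 hi
    simp [show j - i ≠ 0 by omega]

theorem StieltjesNonneg.compression {m : ℕ} (h : StieltjesNonneg α m s) :
    StieltjesNonneg α m (compression s m) := by
  have hE := (mpInv_spec (s 0)).hermitian_left
  refine StieltjesNonneg.congr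
    (s := fun j => s 0 * mpInv (s 0) * s j * (s 0 * mpInv (s 0))ᴴ) ?_ fun j hj => ?_
  · refine .of_hankel (fun n hn => (h.hankel hn).compress _) fun n hn => ?_
    have := (h.hankel_rightShift hn).compress (s 0 * mpInv (s 0))
    convert this using 1
    funext j
    simp [rightShift, mul_add, add_mul]
  · rw [hE, StieltjesSchur.compression, if_pos hj]

theorem StieltjesNonneg.schurTransform {m : ℕ} (h : StieltjesNonneg α (m + 1) s) :
    StieltjesNonneg α m (schurTransform (α : ℂ) s) ∧
      (∀ j < m, stieltjesParam (α : ℂ) (schurTransform (α : ℂ) s) j =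
        stieltjesParam (α : ℂ) s (j + 1)) ∧
      stieltjesParam (α : ℂ) (schurTransform (α : ℂ) s) m =
        stieltjesParam (α : ℂ) s (m + 1) - defectTerm (α : ℂ) s (m + 1) 0 := by
  set e := s 0 * mpInv (s 0) with he
  -- Continuation by zero makes the Hermitian and corner identities hold at every index, as the
  -- power series arguments require.
  obtain ⟨s', hs'⟩ : ∃ s', s' = StieltjesSchur.compression s (m + 1) := ⟨_, rfl⟩
  have hK := h.compression
  rw [← hs'] at hK
  have heH : eᴴ = e := (mpInv_spec (s 0)).hermitian_left
  have hee : e * e = e := by rw [he, ← mul_assoc, (mpInv_spec (s 0)).mul_mul_left]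
  clear_value e
  have hlt : ∀ j < m + 1, s' j = s j := fun j hj => by
    rw [hs', StieltjesSchur.compression, if_pos hj.le, h.proj_mul hj, h.mul_proj hj]
  have h0 : s' 0 = s 0 := hlt 0 (Nat.succ_pos m)
  have hherm : ∀ j, (s' j)ᴴ = s' j := fun j => by
    rw [hs', StieltjesSchur.compression, ← he]
    split_ifs with hj
    · rw [conjTranspose_mul, conjTranspose_mul, heH, h.conjTranspose_eq hj, mul_assoc]
    · simp
  have hes : ∀ j, s' 0 * mpInv (s' 0) * s' j = s' j := fun j => by
    rw [h0, ← he, hs', StieltjesSchur.compression, ← he]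
    split_ifs with hj
    · rw [← mul_assoc, ← mul_assoc, hee]
    · simp
  obtain ⟨h1, h2⟩ := hK.schurTransform_of_compressed hherm hes
  have hce : ∀ j ≤ m + 1, e * s' j * e = e * s j * e := fun j hj => by
    rw [hs', StieltjesSchur.compression, if_pos hj, ← he]
    simp only [← mul_assoc, hee]
    rw [mul_assoc _ e e, hee]
  have ht : ∀ j ≤ m, StieltjesSchur.schurTransform (α : ℂ) s' j =
      StieltjesSchur.schurTransform (α : ℂ) s j := fun j hj => by
    have := recipSeq_eq_of_compression_eq (u := plusTransform (α : ℂ) s)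
      (u' := plusTransform (α : ℂ) s') (j := j + 1)
      (by rw [plusTransform_zero, h.conjTranspose_eq (Nat.zero_le _)])
      (by rw [plusTransform_zero, plusTransform_zero, h0]) fun i hi => by
        rw [plusTransform_zero, ← he]
        rcases i with _ | i
        · exact hce 0 (Nat.zero_le _)
        · simp only [plusTransform, mul_add, add_mul, mul_neg, neg_mul, mul_smul_comm,
            smul_mul_assoc, hce i (by omega), hce (i + 1) (by omega)]
    rw [StieltjesSchur.schurTransform, StieltjesSchur.schurTransform, h0, this]
  refine ⟨h1.congr ht, fun j hj => ?_, ?_⟩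
  · rw [← stieltjesParam_congr _ fun i hi => ht i (hi.trans hj.le), h2 j hj.le]
    exact stieltjesParam_congr _ fun i hi => hlt i (by omega)
  · rw [← stieltjesParam_congr _ fun i hi => ht i hi, h2 m le_rfl]
    have h3 := stieltjesParam_sub_congr (α : ℂ) hlt
    -- As `s 0` is Hermitian, `mpInv (s 0) * s 0` equals `s 0 * mpInv (s 0)`, so the defect is what
    -- compression removes.
    have h4 : defectTerm (α : ℂ) s (m + 1) 0 = s (m + 1) - s' (m + 1) := by
      rw [defectTerm, schurIter, hs', StieltjesSchur.compression, if_pos le_rfl,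
        mul_assoc _ (mpInv (s 0)) (s 0),
        mpInv_mul_comm_of_isHermitian (h.conjTranspose_eq (Nat.zero_le _))]
    rw [h4, sub_eq_iff_eq_add.1 h3]
    abel

end SchurStep

/-! ### Iteration, peeling off the innermost transform -/

theorem schurIter_succ' {q : ℕ} (c : ℂ) (s : ℕ → Matrix (Fin q) (Fin q) ℂ) (k : ℕ) :
    schurIter c s (k + 1) = schurIter c (schurTransform c s) k := by
  induction k with
  | zero => rfl
  | succ k ih => rw [schurIter, ih, schurIter]

theorem defectTerm_succ {q : ℕ} (c : ℂ) (s : ℕ → Matrix (Fin q) (Fin q) ℂ) (j k : ℕ) :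
    defectTerm c s j (k + 1) = defectTerm c (schurTransform c s) j k := by
  rw [defectTerm, defectTerm, schurIter_succ']

end StieltjesSchur

theorem theoremT1000 (q : ℕ) (α : ℝ) (m : ℕ) (s : ℕ → Matrix (Fin q) (Fin q) ℂ)
    (hs : StieltjesSchur.StieltjesNonneg α m s) (k : ℕ) (hk : k ≤ m) :
    (∀ j : ℕ, k + j < m →
      StieltjesSchur.stieltjesParam (α : ℂ) (StieltjesSchur.schurIter (α : ℂ) s k) j =
        StieltjesSchur.stieltjesParam (α : ℂ) s (k + j)) ∧
    StieltjesSchur.stieltjesParam (α : ℂ) (StieltjesSchur.schurIter (α : ℂ) s k) (m - k) =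
      StieltjesSchur.stieltjesParam (α : ℂ) s m -
        ∑ r ∈ Finset.range k, StieltjesSchur.defectTerm (α : ℂ) s (m - r) r := by
  induction k generalizing m s with
  | zero => simp [StieltjesSchur.schurIter]
  | succ k ih =>
    obtain ⟨m, rfl⟩ : ∃ m', m = m' + 1 := ⟨m - 1, by omega⟩
    obtain ⟨h1, h2, h3⟩ := hs.schurTransform
    obtain ⟨h4, h5⟩ := ih m _ h1 (by omega)
    rw [StieltjesSchur.schurIter_succ']
    refine ⟨fun j hj => ?_, ?_⟩
    · rw [h4 j (by omega), h2 _ (by omega), add_right_comm]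
    -- The summand `r = 0` is the defect of the first step; the others are those of the transformed
    -- sequence, with both indices lowered by one.
    · rw [Nat.add_sub_add_right, h5, h3, Finset.sum_range_succ', Nat.sub_zero]
      simp only [StieltjesSchur.defectTerm_succ, Nat.add_sub_add_right]
      abel
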